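/- Let $a<b$, $I=[a,b]$, $n\ge 2$, $1\le k\le n-1$, and let $\sigma=\{\sigma_1<\dots<\sigma_k\}$ and $\varepsilon=\{\varepsilon_1<\dots<\varepsilon_{n-k}\}$ be subsets of $\{0,\dots,n-1\}$ satisfying condition $(N_a)$: for every $h\in\{1,\dots,n-1\}$, $$\#\{j:\sigma_j<h\}+\#\{j:\varepsilon_j<h\}\ \ge\ h .$$ For $M\in\mathbb R$ let $g_M:I\times I\to\mathbb R$ denote, when it exists, the Green's function of $T_n[M]u=u^{(n)}+Mu$ on $I$ with the boundary conditions $u^{(\sigma_1)}(a)=\dots=u^{(\sigma_k)}(a)=0$, $u^{(\varepsilon_1)}(b)=\dots=u^{(\varepsilon_{n-k})}(b)=0$. That is, $g_M$ is $C^{n-2}$ on $I\times I$ and $C^n$ on each of the triangles $a\le s<t\le b$ and $a\le t<s\le b$, and for every $s\in(a,b)$ the function $g_M(\cdot,s)$ solves $u^{(n)}+Mu=0$ on $I\setminus\{s\}$, satisfies the boundary conditions, and $$\frac{\partial^{n-1}g_M}{\partial t^{n-1}}(s^+,s)=\frac{\partial^{n-1}g_M}{\partial t^{n-1}}(s^-,s)+1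 .$$ A function has constant sign on a set if it is nonnegative on the whole set or nonpositive on the whole set. For $q\in\{1,\dots,n-1\}$ let $c_q$ and $d_q$ be the numbers of elements of $\{\sigma_1-q,\dots,\sigma_k-q\}\cap\{0,\dots,n-q-1\}$ and $\{\varepsilon_1-q,\dots,\varepsilon_{n-k}-q\}\cap\{0,\dots,n-q-1\}$. Let $q\in\{1,\dots,n-1\}$. If for some $M\in\mathbb R$ the Green's function $g_M$ exists and $\frac{\partial^q g_M}{\partial t^q}$ has constant sign on $I\times I$ (off the diagonal $t=s$ if $q=n-1$, since the derivative does not exist there), then $c_q+d_q=n-q$ and $g_M$ (for this $M$) has constant sign on $I\times I$. -/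

import Mathlib

open Set Filter Topology

noncomputable section

/-- The boundary index sets `σ` (orders of the derivatives vanishing at `a`) and `ε` (orders of the
derivatives vanishing at `b`) of a two-point problem of order `n`: `σ` has `k` elements, `ε` has
`n - k` elements, both are contained in `{0, …, n - 1}`, and `1 ≤ k ≤ n - 1`. -/
def BoundaryIndices (n k : ℕ) (σ ε : Finset ℕ) : Prop :=
  1 ≤ k ∧ k ≤ n - 1 ∧ σ ⊆ Finset.range n ∧ ε ⊆ Finset.range n ∧ σ.card = k ∧ ε.card = n - k

/-- Property `(N_a)`: for every `h ∈ {1, …, n - 1}`, at least `h` of the boundary conditions have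
order smaller than `h`. -/
def PropertyNa (n : ℕ) (σ ε : Finset ℕ) : Prop :=
  ∀ h : ℕ, 1 ≤ h → h ≤ n - 1 →
    h ≤ (σ.filter (fun i => i < h)).card + (ε.filter (fun i => i < h)).card

/-- The index set `{σ₁ - q, …, σ_k - q} ∩ {0, …, n - q - 1}` (differences taken in the integers). -/
def shiftedIndices (n q : ℕ) (σ : Finset ℕ) : Finset ℕ :=
  (Finset.range (n - q)).filter (fun i => i + q ∈ σ)

/-- The partial derivative `∂^j g / ∂t^j (t, s)` on the square `[a, b] × [a, b]`; it is one-sided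
at `t = a` and at `t = b`. -/
def partialT (a b : ℝ) (g : ℝ → ℝ → ℝ) (j : ℕ) (t s : ℝ) : ℝ :=
  iteratedDerivWithin j (fun r => g r s) (Icc a b) t

/-- `g` is the (scalar) Green's function of the operator `T_n[M] u = u⁽ⁿ⁾ + M u` on `[a, b]` with
the boundary conditions `u⁽ⁱ⁾(a) = 0` for `i ∈ σ` and `u⁽ⁱ⁾(b) = 0` for `i ∈ ε`. -/
structure IsGreenFunction (n : ℕ) (a b M : ℝ) (σ ε : Finset ℕ) (g : ℝ → ℝ → ℝ) : Prop where
  contDiffOn_square :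
    ContDiffOn ℝ ((n - 2 : ℕ) : WithTop ℕ∞) (fun p : ℝ × ℝ => g p.1 p.2) (Icc a b ×ˢ Icc a b)
  contDiffOn_lower :
    ContDiffOn ℝ (n : WithTop ℕ∞) (fun p : ℝ × ℝ => g p.1 p.2)
      {p : ℝ × ℝ | a ≤ p.2 ∧ p.2 < p.1 ∧ p.1 ≤ b}
  contDiffOn_upper :
    ContDiffOn ℝ (n : WithTop ℕ∞) (fun p : ℝ × ℝ => g p.1 p.2)
      {p : ℝ × ℝ | a ≤ p.1 ∧ p.1 < p.2 ∧ p.2 ≤ b}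
  equation : ∀ s ∈ Ioo a b, ∀ t ∈ Icc a b, t ≠ s → partialT a b g n t s + M * g t s = 0
  jump : ∀ s ∈ Ioo a b, ∃ l : ℝ,
    Tendsto (fun t => partialT a b g (n - 1) t s) (𝓝[<] s) (𝓝 l) ∧
    Tendsto (fun t => partialT a b g (n - 1) t s) (𝓝[>] s) (𝓝 (l + 1))
  boundary_left : ∀ s ∈ Ioo a b, ∀ i ∈ σ, partialT a b g i a s = 0
  boundary_right : ∀ s ∈ Ioo a b, ∀ i ∈ ε, partialT a b g i b s = 0

/-- The part of the square `[a, b] × [a, b]` where the `q`-th partial derivative with respect to `t`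
of the Green's function of an operator of order `n` is defined, for `q ≤ n - 1`: everything if
`q ≤ n - 2`, everything off the diagonal if `q = n - 1`. -/
def derivDomain (n : ℕ) (a b : ℝ) (q : ℕ) : Set (ℝ × ℝ) :=
  {p : ℝ × ℝ | p.1 ∈ Icc a b ∧ p.2 ∈ Icc a b ∧ (q = n - 1 → p.1 ≠ p.2)}

/-- `F` has constant sign on `S`: it is nonnegative on all of `S` or nonpositive on all of `S`. -/
def ConstantSignOn (F : ℝ → ℝ → ℝ) (S : Set (ℝ × ℝ)) : Prop :=
  (∀ p ∈ S, 0 ≤ F p.1 p.2) ∨ (∀ p ∈ S, F p.1 p.2 ≤ 0)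

end

/-! Fix `s` in the open interval and put `u = g(·, s)`, which is not identically zero because of the
jump. Rolle's argument is run on signs rather than zeros. Start from one point where `u ≠ 0`. Each
differentiation costs one sign alternation, and each condition of order `j` at an endpoint restores
one when `u⁽ʲ⁾` is differentiated. Hence `u⁽q⁾` takes alternating signs at `1 + N - q` points, `N`
being the number of conditions of order below `q`; `(N_a)` keeps these counts positive
(`Alternates.of_boundary_conditions`). Constant sign of `u⁽q⁾` allows only one such point, so `N =
q`, which gives the count of shifted indices. The sign at that point is the sign of `u` at the
starting point times a factor independent of `t` and `s`, so `g` has constant sign for interior `s`,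
and by continuity on the square. -/

/-! ### Sign alternations under differentiation -/

/-- `f` takes strictly alternating signs, beginning with the sign of `δ`, at some increasing sequence
of `m` points of `D`. -/
def Alternates (f : ℝ → ℝ) (D : Set ℝ) (m : ℕ) (δ : ℝ) : Prop :=
  ∃ x : ℕ → ℝ, (∀ i < m, x i ∈ D) ∧ (∀ i, i + 1 < m → x i < x (i + 1)) ∧
    ∀ i < m, 0 < δ * (-1) ^ i * f (x i)

/-- `f` has `m` increments of strictly alternating signs, beginning with the sign of `δ`, along some
increasing sequence of `m + 1` points of `D`. -/
def AlternatesIncr (f : ℝ → ℝ) (D : Set ℝ) (m : ℕ) (δ : ℝ) : Prop :=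
  ∃ x : ℕ → ℝ, (∀ i ≤ m, x i ∈ D) ∧ (∀ i < m, x i < x (i + 1)) ∧
    ∀ i < m, 0 < δ * (-1) ^ i * (f (x (i + 1)) - f (x i))

theorem Alternates.mono {f : ℝ → ℝ} {D D' : Set ℝ} {m : ℕ} {δ : ℝ} (h : Alternates f D m δ)
    (hD : D ⊆ D') : Alternates f D' m δ := by
  obtain ⟨x, h1, h2, h3⟩ := h
  exact ⟨x, fun i hi => hD (h1 i hi), h2, h3⟩

/-- Mean value theorem with one exceptional point: if `s` lies inside, the increment splits at `s`
and one of the two parts has the required sign. -/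
theorem exists_deriv_sign_of_increment {f f' : ℝ → ℝ} {x y s c : ℝ} (hxy : x < y)
    (hf : ContinuousOn f (Icc x y)) (hd : ∀ t ∈ Ioo x y, t ≠ s → HasDerivAt f (f' t) t)
    (hc : 0 < c * (f y - f x)) : ∃ ξ ∈ Ioo x y, ξ ≠ s ∧ 0 < c * f' ξ := by
  have key : ∀ u v : ℝ, u < v → x ≤ u → v ≤ y → s ∉ Ioo u v → 0 < c * (f v - f u) →
      ∃ ξ ∈ Ioo x y, ξ ≠ s ∧ 0 < c * f' ξ := by
    intro u v huv hu hv hs hcu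
    have hne : ∀ t ∈ Ioo u v, t ≠ s := fun t ht h => hs (h ▸ ht)
    obtain ⟨ξ, hξ, he⟩ := exists_hasDerivAt_eq_slope f f' huv (hf.mono (Icc_subset_Icc hu hv))
      (fun t ht => hd t ⟨hu.trans_lt ht.1, ht.2.trans_le hv⟩ (hne t ht))
    refine ⟨ξ, ⟨hu.trans_lt hξ.1, hξ.2.trans_le hv⟩, hne ξ hξ, ?_⟩
    rw [he, ← mul_div_assoc]
    exact div_pos hcu (sub_pos.2 huv)
  by_cases hs : s ∈ Ioo x y
  · rcases le_or_gt (c * (f s - f x)) 0 with h | h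
    · exact key s y hs.2 hs.1.le le_rfl (fun h => lt_irrefl _ h.1) (by linarith)
    · exact key x s hs.1 le_rfl hs.2.le (fun h => lt_irrefl _ h.2) h
  · exact key x y hxy le_rfl le_rfl hs hc

theorem AlternatesIncr.deriv {f f' : ℝ → ℝ} {a b s δ : ℝ} {m : ℕ}
    (h : AlternatesIncr f (Icc a b) m δ) (hf : ContinuousOn f (Icc a b))
    (hd : ∀ t ∈ Ioo a b, t ≠ s → HasDerivAt f (f' t) t) :
    Alternates f' (Ioo a b \ {s}) m δ := by
  obtain ⟨x, hx, hlt, hinc⟩ := h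
  have key : ∀ i, ∃ ξ, i < m → ξ ∈ Ioo (x i) (x (i + 1)) ∧ ξ ≠ s ∧ 0 < δ * (-1) ^ i * f' ξ := by
    intro i
    by_cases hi : i < m
    · have h1 := hx i hi.le
      have h2 := hx (i + 1) hi
      obtain ⟨ξ, h⟩ := exists_deriv_sign_of_increment (s := s) (f' := f') (hlt i hi)
        (hf.mono (Icc_subset_Icc h1.1 h2.2))
        (fun t ht => hd t ⟨h1.1.trans_lt ht.1, ht.2.trans_le h2.2⟩) (hinc i hi)
      exact ⟨ξ, fun _ => h⟩
    · exact ⟨0, fun h => absurd h hi⟩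
  choose y hy using key
  refine ⟨y, fun i hi => ⟨⟨?_, ?_⟩, (hy i hi).2.1⟩, fun i hi => ?_, fun i hi => (hy i hi).2.2⟩
  · exact (hx i hi.le).1.trans_lt (hy i hi).1.1
  · exact (hy i hi).1.2.trans_le (hx (i + 1) hi).2
  · exact (hy i (by omega)).1.2.trans (hy (i + 1) hi).1.1

/-- Sign alternations give alternating increments; a zero at an endpoint gives one more. -/
theorem Alternates.alternatesIncr {f : ℝ → ℝ} {a b δ : ℝ} {m : ℕ} {A B : Prop} [Decidable A]
    [Decidable B] (h : Alternates f (Icc a b) (m + 1) δ) (hA : A → f a = 0) (hB : B → f b = 0) :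
    AlternatesIncr f (Icc a b) (m + (if A then 1 else 0) + (if B then 1 else 0))
      (if A then δ else -δ) := by
  obtain ⟨x, hx, hlt, hs⟩ := h
  have hab : a ≤ b := (hx 0 (by omega)).1.trans (hx 0 (by omega)).2
  -- The sign at `y 0` is kept because prepending `a` needs it.
  have hB' : ∃ y : ℕ → ℝ, (∀ i ≤ m + (if B then 1 else 0), y i ∈ Icc a b) ∧
      (∀ i < m + (if B then 1 else 0), y i < y (i + 1)) ∧
      (∀ i < m + (if B then 1 else 0), 0 < -δ * (-1) ^ i * (f (y (i + 1)) - f (y i))) ∧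
      0 < δ * f (y 0) := by
    have hinc : ∀ i < m, 0 < -δ * (-1) ^ i * (f (x (i + 1)) - f (x i)) := by
      intro i hi
      have h1 := hs i (by omega)
      have h2 := hs (i + 1) (by omega)
      rw [pow_succ] at h2
      linarith
    have h0 : 0 < δ * f (x 0) := by simpa using hs 0 (by omega)
    by_cases hb : B
    · simp only [hb, if_true]
      refine ⟨fun i => if i ≤ m then x i else b, fun i _ => ?_, fun i hi => ?_, fun i hi => ?_, ?_⟩
      · dsimp only
        split_ifs with h
        · exact hx i (by omega)
        · exact ⟨hab, le_rfl⟩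
      · dsimp only
        rw [if_pos (show i ≤ m by omega)]
        split_ifs with h
        · exact hlt i (by omega)
        · refine lt_of_le_of_ne (hx i hi).2 fun he => ?_
          have := hs i hi
          rw [he, hB hb] at this
          simp at this
      · dsimp only
        rw [if_pos (show i ≤ m by omega)]
        split_ifs with h
        · exact hinc i (by omega)
        · have := hs i hi
          rw [hB hb]
          linarith
      · simpa using h0
    · simp only [hb, if_false, add_zero]
      exact ⟨x, fun i hi => hx i (by omega), fun i hi => hlt i (by omega), hinc, h0⟩
  obtain ⟨y, hy, hylt, hyinc, hy0⟩ := hB'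
  by_cases ha : A
  · simp only [ha, if_true]
    -- The new first increment is `f (y 0) - 0`, of sign `δ`; the old ones, which began with `-δ`,
    -- move up one index.
    refine ⟨fun i => Nat.casesOn i a y, fun i hi => ?_, fun i hi => ?_, fun i hi => ?_⟩
    · cases i with
      | zero => exact ⟨le_rfl, hab⟩
      | succ i => exact hy i (by omega)
    · cases i with
      | zero =>
        refine lt_of_le_of_ne (hy 0 (by omega)).1 fun he => ?_
        have he' : y 0 = a := he.symm
        rw [he', hA ha] at hy0
        simp at hy0
      | succ i => exact hylt i (by omega)
    · cases i with
      | zero => simpa [hA ha] using hy0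
      | succ i =>
        have := hyinc i (by omega)
        rw [pow_succ]
        dsimp only
        linarith
  · simp only [ha, if_false, add_zero]
    exact ⟨y, hy, hylt, hyinc⟩

theorem card_filter_lt_succ (S : Finset ℕ) (j : ℕ) :
    (S.filter (fun i => i < j + 1)).card =
      (S.filter (fun i => i < j)).card + (if j ∈ S then 1 else 0) := by
  have h : S.filter (fun i => i < j + 1) =
      S.filter (fun i => i < j) ∪ S.filter (fun i => i = j) := by
    ext i
    simp only [Finset.mem_filter, Finset.mem_union]
    grind
  rw [h, Finset.card_union_of_disjoint]
  · congr 1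
    rw [Finset.filter_eq']
    split_ifs <;> simp
  · rw [Finset.disjoint_left]
    grind

/-- Two-point boundary conditions on the derivatives of lower order force the derivative of order
`p + 1` to alternate in sign at least as often as they exceed the order `p + 1`. -/
theorem Alternates.of_boundary_conditions {F : ℕ → ℝ → ℝ} {a b s δ t₀ : ℝ} {σ ε : Finset ℕ} {p : ℕ}
    (hF : ∀ j ≤ p, ContinuousOn (F j) (Icc a b))
    (hd : ∀ j ≤ p, ∀ t ∈ Ioo a b, t ≠ s → HasDerivAt (F j) (F (j + 1) t) t)
    (hσ : ∀ j ≤ p, j ∈ σ → F j a = 0) (hε : ∀ j ≤ p, j ∈ ε → F j b = 0)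
    (hN : ∀ h, h ≤ p →
      h ≤ (σ.filter (fun i => i < h)).card + (ε.filter (fun i => i < h)).card)
    (ht₀ : t₀ ∈ Icc a b) (h0 : 0 < δ * F 0 t₀) :
    ∃ m, m + (p + 1) =
        1 + (σ.filter (fun i => i < p + 1)).card + (ε.filter (fun i => i < p + 1)).card ∧
      Alternates (F (p + 1)) (Ioo a b \ {s}) m
        (δ * (-1) ^ (p + 1 + (σ.filter (fun i => i < p + 1)).card)) := by
  have step : ∀ j ≤ p, ∀ m, m + j =
        1 + (σ.filter (fun i => i < j)).card + (ε.filter (fun i => i < j)).card →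
      Alternates (F j) (Icc a b) m (δ * (-1) ^ (j + (σ.filter (fun i => i < j)).card)) →
      ∃ m', m' + (j + 1) =
        1 + (σ.filter (fun i => i < j + 1)).card + (ε.filter (fun i => i < j + 1)).card ∧
      Alternates (F (j + 1)) (Ioo a b \ {s}) m'
        (δ * (-1) ^ (j + 1 + (σ.filter (fun i => i < j + 1)).card)) := by
    intro j hj m hm hA
    have hNj := hN j hj
    -- `(N_a)` at `j` leaves at least one point to continue from.
    obtain ⟨m, rfl⟩ : ∃ r, m = r + 1 := ⟨m - 1, by omega⟩
    have h := (hA.alternatesIncr (hσ j hj) (hε j hj)).deriv (hF j hj) (hd j hj)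
    refine ⟨m + (if j ∈ σ then 1 else 0) + (if j ∈ ε then 1 else 0), ?_, ?_⟩
    · rw [card_filter_lt_succ, card_filter_lt_succ]
      omega
    · convert h using 1
      rw [card_filter_lt_succ]
      split_ifs <;> ring
  have main : ∀ j ≤ p, ∃ m, m + j =
        1 + (σ.filter (fun i => i < j)).card + (ε.filter (fun i => i < j)).card ∧
      Alternates (F j) (Icc a b) m (δ * (-1) ^ (j + (σ.filter (fun i => i < j)).card)) := by
    intro j
    induction j with
    | zero =>
      intro _
      refine ⟨1, by simp, fun _ => t₀, fun _ _ => ht₀, fun i hi => by omega, fun i hi => ?_⟩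
      obtain rfl : i = 0 := by omega
      simpa using h0
    | succ j ih =>
      intro hj
      obtain ⟨m, hm, hA⟩ := ih (by omega)
      obtain ⟨m', hm', hA'⟩ := step j (by omega) m hm hA
      exact ⟨m', hm', hA'.mono fun t ht => Ioo_subset_Icc_self ht.1⟩
  obtain ⟨m, hm, hA⟩ := main p le_rfl
  exact step p le_rfl m hm hA

/-- Where `f ≠ 0` it has the sign of `c`, so a second alternation point would contradict the first.
-/
theorem Alternates.eq_one_of_nonneg {f : ℝ → ℝ} {D : Set ℝ} {m : ℕ} {δ c : ℝ}
    (h : Alternates f D m δ) (hm : 1 ≤ m) (hc : c ≠ 0)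
    (hf : ∀ t ∈ D, 0 ≤ c * f t) :
    m = 1 ∧ 0 < δ * c := by
  obtain ⟨x, hx, -, hs⟩ := h
  have hpos : ∀ i < m, 0 < δ * (-1) ^ i * c := by
    intro i hi
    have h1 := hs i hi
    have hne : f (x i) ≠ 0 := right_ne_zero_of_mul h1.ne'
    have h2 : 0 < c * f (x i) := lt_of_le_of_ne (hf _ (hx i hi)) (mul_ne_zero hc hne).symm
    refine pos_of_mul_pos_left (b := f (x i) * f (x i)) ?_ (mul_self_nonneg _)
    calc 0 < δ * (-1) ^ i * f (x i) * (c * f (x i)) := mul_pos h1 h2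
      _ = _ := by ring
  have h0 : 0 < δ * c := by simpa using hpos 0 hm
  refine ⟨?_, h0⟩
  by_contra hne
  have h1 := hpos 1 (by omega)
  linarith

/-! ### Slices of the Green's function -/

section Green

variable {n : ℕ} {a b M : ℝ} {σ ε : Finset ℕ} {g : ℝ → ℝ → ℝ}

theorem IsGreenFunction.contDiffOn_slice (hg : IsGreenFunction n a b M σ ε g) {s : ℝ}
    (hs : s ∈ Icc a b) : ContDiffOn ℝ ((n - 2 : ℕ) : WithTop ℕ∞) (fun r => g r s) (Icc a b) :=
  hg.contDiffOn_square.comp (f := fun r : ℝ => (r, s)) (by fun_prop) fun _ hr => ⟨hr, hs⟩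

theorem IsGreenFunction.contDiffAt_slice (hg : IsGreenFunction n a b M σ ε g) {s t : ℝ}
    (hs : s ∈ Ioo a b) (ht : t ∈ Ioo a b) (hts : t ≠ s) :
    ContDiffAt ℝ (n : WithTop ℕ∞) (fun r => g r s) t := by
  rcases lt_or_gt_of_ne hts with h | h
  · have : ContDiffOn ℝ (n : WithTop ℕ∞) (fun r => g r s) (Ioo a s) :=
      hg.contDiffOn_upper.comp (f := fun r : ℝ => (r, s)) (by fun_prop)
        fun r hr => ⟨hr.1.le, hr.2, hs.2.le⟩
    exact this.contDiffAt (Ioo_mem_nhds ht.1 h)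
  · have : ContDiffOn ℝ (n : WithTop ℕ∞) (fun r => g r s) (Ioo s b) :=
      hg.contDiffOn_lower.comp (f := fun r : ℝ => (r, s)) (by fun_prop)
        fun r hr => ⟨hs.1.le, hr.1, hr.2.le⟩
    exact this.contDiffAt (Ioo_mem_nhds h ht.2)

theorem IsGreenFunction.continuousOn_partialT (hg : IsGreenFunction n a b M σ ε g) (hab : a < b)
    {s : ℝ} (hs : s ∈ Icc a b) {j : ℕ} (hj : j ≤ n - 2) :
    ContinuousOn (fun t => partialT a b g j t s) (Icc a b) :=
  (hg.contDiffOn_slice hs).continuousOn_iteratedDerivWithin (by exact_mod_cast hj)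
    (uniqueDiffOn_Icc hab)

theorem IsGreenFunction.hasDerivAt_partialT (hg : IsGreenFunction n a b M σ ε g) (hab : a < b)
    {s t : ℝ} (hs : s ∈ Ioo a b) (ht : t ∈ Ioo a b) (hts : t ≠ s) {j : ℕ} (hj : j < n) :
    HasDerivAt (fun t => partialT a b g j t s) (partialT a b g (j + 1) t s) t := by
  have h := (hg.contDiffAt_slice hs ht hts).contDiffWithinAt (s := Icc a b)
  have hI : Icc a b ∈ 𝓝 t := Icc_mem_nhds ht.1 ht.2
  have hdw : DifferentiableWithinAt ℝ (iteratedDerivWithin j (fun r => g r s) (Icc a b))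
      (Icc a b) t :=
    h.differentiableWithinAt_iteratedDerivWithin (by exact_mod_cast hj)
      (by rw [insert_eq_of_mem (Ioo_subset_Icc_self ht)]; exact uniqueDiffOn_Icc hab)
  have := (hdw.differentiableAt hI).hasDerivAt
  rwa [← derivWithin_of_mem_nhds hI, ← iteratedDerivWithin_succ] at this

/-- A zero slice could not have a unit jump in its derivative of order `n - 1`. -/
theorem IsGreenFunction.exists_ne_zero (hg : IsGreenFunction n a b M σ ε g)
    {s : ℝ} (hs : s ∈ Ioo a b) : ∃ t ∈ Icc a b, g t s ≠ 0 := by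
  by_contra! h
  obtain ⟨l, h1, h2⟩ := hg.jump s hs
  have hz : ∀ t ∈ Icc a b, partialT a b g (n - 1) t s = 0 := by
    intro t ht
    have := iteratedDerivWithin_congr (n := n - 1) (f := fun r => g r s) (g := fun _ => (0 : ℝ))
      (s := Icc a b) (fun r hr => h r hr) ht
    rw [partialT, this]
    simp
  have hev : ∀ᶠ t in 𝓝 s, partialT a b g (n - 1) t s = 0 := by
    filter_upwards [Icc_mem_nhds hs.1 hs.2] with t ht using hz t ht
  have e1 : l = 0 := tendsto_nhds_unique h1
    (tendsto_const_nhds.congr' ((hev.filter_mono nhdsWithin_le_nhds).mono fun t ht => ht.symm))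
  have e2 : l + 1 = 0 := tendsto_nhds_unique h2
    (tendsto_const_nhds.congr' ((hev.filter_mono nhdsWithin_le_nhds).mono fun t ht => ht.symm))
  linarith

/-- If `c * ∂^q g / ∂t^q` is nonnegative, then the conditions of order less than `q` are exactly `q`
in number, and they determine the sign of `g`. -/
theorem IsGreenFunction.sign_of_partialT_nonneg (hg : IsGreenFunction n a b M σ ε g) (hab : a < b)
    (hNa : PropertyNa n σ ε) {q : ℕ} (hq1 : 1 ≤ q) (hqn : q ≤ n - 1) {c : ℝ} (hc0 : c ≠ 0)
    (hc : ∀ p ∈ derivDomain n a b q, 0 ≤ c * partialT a b g q p.1 p.2)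
    {s t δ : ℝ} (hs : s ∈ Ioo a b) (ht : t ∈ Icc a b) (h0 : 0 < δ * g t s) :
    (σ.filter (fun i => i < q)).card + (ε.filter (fun i => i < q)).card = q ∧
      0 < δ * (-1) ^ (q + (σ.filter (fun i => i < q)).card) * c := by
  obtain ⟨p, rfl⟩ : ∃ p, q = p + 1 := ⟨q - 1, by omega⟩
  obtain ⟨m, hm, hA⟩ := Alternates.of_boundary_conditions (σ := σ) (ε := ε) (p := p) (δ := δ)
    (F := fun j t => partialT a b g j t s) (s := s)
    (fun j hj => hg.continuousOn_partialT hab (Ioo_subset_Icc_self hs) (by omega))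
    (fun j hj t ht hts => hg.hasDerivAt_partialT hab hs ht hts (by omega))
    (fun j _ hj => hg.boundary_left s hs j hj) (fun j _ hj => hg.boundary_right s hs j hj)
    (fun h hh => by
      rcases Nat.eq_zero_or_pos h with rfl | hpos
      · exact Nat.zero_le _
      · exact hNa h hpos (by omega))
    ht (by simpa [partialT] using h0)
  have hNq := hNa (p + 1) hq1 hqn
  -- The alternation points avoid `s`, so they lie in the domain even when `q = n - 1`.
  obtain ⟨h1, h2⟩ := hA.eq_one_of_nonneg (c := c) (by omega) hc0 fun r hr =>
    hc (r, s) ⟨Ioo_subset_Icc_self hr.1, Ioo_subset_Icc_self hs, fun _ => hr.2⟩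
  exact ⟨by omega, h2⟩

end Green

/-! ### Index count and conclusion -/

/-- Adding `q` maps the shifted indices bijectively onto the elements of `S` that are at least `q`.
-/
theorem card_shiftedIndices {n q : ℕ} {S : Finset ℕ} (hS : S ⊆ Finset.range n) :
    (shiftedIndices n q S).card + (S.filter (fun i => i < q)).card = S.card := by
  have h : (shiftedIndices n q S).map (addRightEmbedding q) = S.filter (fun i => ¬ i < q) := by
    ext i
    simp only [shiftedIndices, Finset.mem_map, Finset.mem_filter, Finset.mem_range,
      addRightEmbedding_apply, not_lt]
    constructor
    · rintro ⟨j, ⟨_, hj⟩, rfl⟩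
      exact ⟨hj, by omega⟩
    · rintro ⟨hi, hqi⟩
      have := Finset.mem_range.1 (hS hi)
      exact ⟨i - q, ⟨by omega, by rwa [Nat.sub_add_cancel hqi]⟩, Nat.sub_add_cancel hqi⟩
  rw [← Finset.card_map (addRightEmbedding q), h, add_comm,
    Finset.card_filter_add_card_filter_not]

/-- A continuous function on the square is nonnegative as soon as it is so for interior `s`. -/
theorem nonneg_on_square_of_interior {a b : ℝ} (hab : a < b) {f : ℝ → ℝ → ℝ}
    (hf : ContinuousOn (fun p : ℝ × ℝ => f p.1 p.2) (Icc a b ×ˢ Icc a b))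
    (h : ∀ t ∈ Icc a b, ∀ s ∈ Ioo a b, 0 ≤ f t s) :
    ∀ p ∈ Icc a b ×ˢ Icc a b, 0 ≤ f p.1 p.2 := by
  rintro ⟨t, s⟩ ⟨ht, hs⟩
  have hc : ContinuousOn (fun s => f t s) (closure (Ioo a b)) := by
    rw [closure_Ioo hab.ne]
    exact hf.comp (f := fun s : ℝ => (t, s)) (by fun_prop) fun _ hr => ⟨ht, hr⟩
  have hs' : s ∈ closure (Ioo a b) := by rwa [closure_Ioo hab.ne]
  exact le_on_closure (h t ht) continuousOn_const hc hs'

theorem mainTheorem8 (n k q : ℕ) (a b : ℝ) (hab : a < b) (σ ε : Finset ℕ)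
    (hind : BoundaryIndices n k σ ε) (hq1 : 1 ≤ q) (hqn : q ≤ n - 1)
    (hNa : PropertyNa n σ ε) (M : ℝ) (g : ℝ → ℝ → ℝ)
    (hg : IsGreenFunction n a b M σ ε g)
    (hsign : ConstantSignOn (partialT a b g q) (derivDomain n a b q)) :
    (shiftedIndices n q σ).card + (shiftedIndices n q ε).card = n - q ∧
      ConstantSignOn g (Icc a b ×ˢ Icc a b) := by
  obtain ⟨hk1, hkn, hσ, hε, hσc, hεc⟩ := hind
  obtain ⟨c, hc0, hc⟩ : ∃ c : ℝ, c ≠ 0 ∧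
      ∀ p ∈ derivDomain n a b q, 0 ≤ c * partialT a b g q p.1 p.2 := by
    rcases hsign with h | h
    · exact ⟨1, one_ne_zero, fun p hp => by simpa using h p hp⟩
    · exact ⟨-1, by norm_num, fun p hp => by simpa using h p hp⟩
  have key := fun {s t δ : ℝ} => hg.sign_of_partialT_nonneg hab hNa hq1 hqn hc0 hc (s := s) (t := t)
    (δ := δ)
  have hcard : (σ.filter (fun i => i < q)).card + (ε.filter (fun i => i < q)).card = q := by
    have hs : (a + b) / 2 ∈ Ioo a b := ⟨by linarith, by linarith⟩
    obtain ⟨t, ht, hne⟩ := hg.exists_ne_zero hs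
    exact (key hs ht (mul_self_pos.2 hne)).1
  have h1 := card_shiftedIndices (q := q) hσ
  have h2 := card_shiftedIndices (q := q) hε
  refine ⟨by omega, ?_⟩
  -- With `δ = g t s`, the sign relation in `key` reads `0 < g t s * C`, and `C` depends on neither
  -- `t` nor `s`.
  set C : ℝ := (-1) ^ (q + (σ.filter (fun i => i < q)).card) * c with hC
  have hcont : ContinuousOn (fun p : ℝ × ℝ => g p.1 p.2) (Icc a b ×ˢ Icc a b) :=
    hg.contDiffOn_square.continuousOn
  have hC0 : C ≠ 0 := mul_ne_zero (pow_ne_zero _ (by norm_num)) hc0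
  have hsgn : ∀ t ∈ Icc a b, ∀ s ∈ Ioo a b, 0 ≤ C * g t s := by
    intro t ht s hs
    rcases eq_or_ne (g t s) 0 with h | h
    · simp [h]
    · have := (key hs ht (mul_self_pos.2 h)).2
      rw [mul_assoc, ← hC, mul_comm] at this
      exact this.le
  have hall := nonneg_on_square_of_interior hab (f := fun t s => C * g t s)
    (continuousOn_const.mul hcont) hsgn
  rcases lt_or_gt_of_ne hC0 with h | h
  · exact Or.inr fun p hp => nonpos_of_mul_nonneg_right (hall p hp) h
  · exact Or.inl fun p hp => nonneg_of_mul_nonneg_right (hall p hp) h
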